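/- \textbf{Model.} Let $0\le a<b_{0}<\infty$ and let $F$ be a distribution on $[a,b_0]$ (bounded abilities) with a density $f$ that is continuous and strictly positive on $(a,b_0)$ and vanishes outside $[a,b_0]$. There are $n\ge 2$ registered contestants, whose abilities $x_1,\dots,x_n$ are drawn independently from $F$. Effort $e$ costs a contestant of ability $x$ the amount $ke/x$, where $k>0$. A contest with budget $B>0$ consists of a shortlist size $2\le m\le n$ and prizes $V_1\ge V_2\ge\dots\ge V_m\ge 0$ with $\sum_{l=1}^m V_l\le B$. The $m$ contestants with the highest abilities are admitted. An admitted contestant of ability $x$ exerts the effort given by the closed-form equilibrium expression $$b_{m,V}(x)=\frac1k\int_0^x \frac{\sum_{l=1}^{m-1}\binom{n-1}{l-1}(n-l)(V_l-V_{l+1})F(t)^{n-l-1}(1-F(t))^{l-1}f(t)}{\sum_{j=1}^{m}\binom{n-1}{j-1}F(t)^{n-j}(1-F(t))^{j-1}}\;t\,dt ,$$ where the integrand is $0$ wherever $f(t)=0$. A contestant who is not admitted exerts effort $0$. The total effort $\mathrm{TE}(m,V)$ is the expectation, over $x_1,\dots,x_n$, of the sum of all efforts. Let $S(m,n,l)$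 be the total effort of the contest with shortlist size $m$ and $l$ equal prizes $V_1=\dots=V_l=B/l$, the other prizes being $0$. In particular, $S(m,n,m-1)$ is the total effort of the complete simple contest of size $m$, and $S(n,n,1)$ that of the $n$-contestant winner-take-all contest. An optimal shortlist size $m^*=m^*(F,n)$ is one that maximizes $S(m,n,m-1)$ over $2\le m\le n$. \textbf{Theorem (total-effort gain of the optimal shortlist).} Fix such an $F$. Then $$\frac{S(m^*,n,m^*-1)}{S(n,n,1)}=\Theta(n)\qquad(n\to\infty).$$ Moreover, a contest that maximizes the total effort among all contests $(m,V)$ with $n$ registered contestants achieves $\Theta(n)$ times the total effort of a contest that maximizes it among those without a shortlist (that is, with $m=n$). Precisely, there are constants $c_1,c_2>0$ and $N$, depending only on $F$, such that for all $n\ge N$, all $k,B>0$ and all choices of the maximizers, both ratios lie between $c_1n$ and $c_2n$. -/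

import Mathlib

open MeasureTheory ProbabilityTheory

/-- A distribution of bounded positive abilities: a probability density `f` on `ℝ` that is
continuous and strictly positive on a bounded interval `(lo, hi)` with `0 ≤ lo < hi`, and
vanishes outside `[lo, hi]`. -/
structure AbilityDistribution where
  lo : ℝ
  hi : ℝ
  f : ℝ → ℝ
  lo_nonneg : 0 ≤ lo
  lo_lt_hi : lo < hi
  f_nonneg : ∀ x, 0 ≤ f x
  f_continuousOn : ContinuousOn f (Set.Ioo lo hi)
  f_pos : ∀ x ∈ Set.Ioo lo hi, 0 < f x
  f_eq_zero : ∀ x, x ∉ Set.Icc lo hi → f x = 0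
  integral_f : ∫ x, f x = 1

namespace AbilityDistribution

/-- The law of one ability: the measure with density `f`. -/
noncomputable def law (D : AbilityDistribution) : Measure ℝ :=
  volume.withDensity fun x => ENNReal.ofReal (D.f x)

instance (D : AbilityDistribution) : IsProbabilityMeasure D.law := by
  have hint : Integrable D.f := by
    by_contra h
    have h1 := D.integral_f
    rw [integral_undef h] at h1
    exact zero_ne_one h1
  constructor
  rw [law, withDensity_apply _ MeasurableSet.univ, Measure.restrict_univ,
    ← ofReal_integral_eq_lintegral_ofReal hint (Filter.Eventually.of_forall D.f_nonneg),
    D.integral_f, ENNReal.ofReal_one]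

/-- The cumulative distribution function of an ability. -/
noncomputable def F (D : AbilityDistribution) (t : ℝ) : ℝ := cdf D.law t

end AbilityDistribution

/-- `J(F, n, m, t)`: the probability that a contestant of ability `t` is among the `m` most able
of `n` contestants, when the other `n - 1` abilities are drawn independently from `F`. -/
noncomputable def admissionProb (D : AbilityDistribution) (n m : ℕ) (t : ℝ) : ℝ :=
  ∑ j ∈ Finset.Icc 1 m, ((n - 1).choose (j - 1) : ℝ) * D.F t ^ (n - j) * (1 - D.F t) ^ (j - 1)

/-- The closed-form equilibrium effort of an admitted contestant of ability `x`, with `n` registered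
contestants, shortlist size `m`, prizes `V 1, …, V m` and linear cost function `g(e) = k e`. -/
noncomputable def equilibriumEffort (D : AbilityDistribution) (k : ℝ) (n m : ℕ) (V : ℕ → ℝ)
    (x : ℝ) : ℝ :=
  k⁻¹ * ∫ t in (0 : ℝ)..x,
    (∑ l ∈ Finset.Icc 1 (m - 1), ((n - 1).choose (l - 1) : ℝ) * ((n : ℝ) - l)
        * (V l - V (l + 1)) * D.F t ^ (n - l - 1) * (1 - D.F t) ^ (l - 1) * D.f t)
      / admissionProb D n m t * t

open Classical in
/-- The ex-ante total effort: the expectation, over `n` independent abilities, of the sum of the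
efforts of the contestants that are admitted (those with fewer than `m` contestants of strictly
higher ability); a contestant that is not admitted exerts no effort. -/
noncomputable def totalEffort (D : AbilityDistribution) (k : ℝ) (n m : ℕ) (V : ℕ → ℝ) : ℝ :=
  ∫ x : Fin n → ℝ,
    ∑ i, (if (Finset.univ.filter fun j => x i < x j).card < m
      then equilibriumEffort D k n m V (x i) else 0)
    ∂(Measure.pi fun _ : Fin n => D.law)

/-- A contest with `n` registered contestants and budget `B`: a shortlist size `m` and prizes
`V 1 ≥ V 2 ≥ … ≥ V m ≥ 0` of sum at most `B` (values of `prize` outside `1, …, m` play no role). -/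
structure Contest (B : ℝ) (n : ℕ) where
  size : ℕ
  two_le_size : 2 ≤ size
  size_le : size ≤ n
  prize : ℕ → ℝ
  prize_antitone : AntitoneOn prize (Set.Icc 1 size)
  prize_nonneg : ∀ l ∈ Set.Icc 1 size, 0 ≤ prize l
  budget : ∑ l ∈ Finset.Icc 1 size, prize l ≤ B

/-- The total effort of a contest. -/
noncomputable def Contest.TE {B : ℝ} {n : ℕ} (C : Contest B n) (D : AbilityDistribution)
    (k : ℝ) : ℝ :=
  totalEffort D k n C.size C.prize

/-- `C` maximizes the total effort among all contests (shortlist size and prizes are free). -/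
def Contest.IsOptimal {B : ℝ} {n : ℕ} (C : Contest B n) (D : AbilityDistribution) (k : ℝ) :
    Prop :=
  ∀ C' : Contest B n, C'.TE D k ≤ C.TE D k

/-- `C` admits all `n` contestants and maximizes the total effort among the contests that do. -/
def Contest.IsOptimalWithoutShortlist {B : ℝ} {n : ℕ} (C : Contest B n)
    (D : AbilityDistribution) (k : ℝ) : Prop :=
  C.size = n ∧ ∀ C' : Contest B n, C'.size = n → C'.TE D k ≤ C.TE D k

/-- `S(m, n, l)`: the total effort of the simple contest with shortlist size `m` that divides the
budget equally into `l` prizes. -/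
noncomputable def simpleTotalEffort (D : AbilityDistribution) (k B : ℝ) (m n l : ℕ) : ℝ :=
  totalEffort D k n m fun r => if r ≤ l then B / l else 0

/-- `m` is an optimal shortlist size: it maximizes, over `2 ≤ m ≤ n`, the total effort
`S(m, n, m - 1)` of the complete simple contest with shortlist size `m`. -/
def IsOptimalSize (D : AbilityDistribution) (k B : ℝ) (n m : ℕ) : Prop :=
  2 ≤ m ∧ m ≤ n ∧ ∀ m' : ℕ, 2 ≤ m' → m' ≤ n →
    simpleTotalEffort D k B m' n (m' - 1) ≤ simpleTotalEffort D k B m n (m - 1)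

/-! Write N = n - 1, let J be the admission probability at ability quantile p (`binomialTail`), d_l
the derivative in p of the tail of size l (`rankDensity`), and U the integral of J over [p, 1]
(`upperTail`). Exchanging the order of integration (`totalEffort_eq`) turns total effort into n/k
times the mean of t · Σ (V_l - V_{l+1}) (d_l / J) U, evaluated at p = F(t).

Everything rests on d_l · (1 - p) = l · (l-th Bernstein term). Since that term is at most J for l <
m, and U ≤ 1 - p, each (d_l / J) U is at most l. Abel summation of the prizes then bounds every
contest by n · hi · B / k (`TE_le`). Without a shortlist J = 1 and U = 1 - p, so the exact Bernstein
term remains; its integral 1/n cancels the factor n and leaves hi · B / k (`TE_le_of_size_eq`).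

Both orders are attained. The winner-take-all contest retains a constant share of its Bernstein mass
above the first quartile a (`simpleTotalEffort_full_ge`). With l about n/4 prizes and a shortlist of
l + 1, the terms of J at least double up to the last one when p ≤ 1/2, so d_l / J ≥ l/2, while U ≥
1/8; quantiles between 1/4 and 1/2 alone then give order n (`simpleTotalEffort_ge`). Dividing the
four bounds gives both ratios. -/

/-! ### Binomial tails and Bernstein integrals -/

/-- The probability that a binomial variable with `N` trials and success probability `1 - p`
is less than `m`. -/
noncomputable def binomialTail (N m : ℕ) (p : ℝ) : ℝ :=
  ∑ r ∈ Finset.range m, (N.choose r : ℝ) * p ^ (N - r) * (1 - p) ^ r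

theorem continuous_binomialTail (N m : ℕ) : Continuous (binomialTail N m) := by
  unfold binomialTail
  fun_prop

theorem binomialTail_nonneg (N m : ℕ) {p : ℝ} (h0 : 0 ≤ p) (h1 : p ≤ 1) :
    0 ≤ binomialTail N m p :=
  Finset.sum_nonneg fun r _ => by
    have : 0 ≤ 1 - p := by linarith
    positivity

theorem binomialTail_mono_size (N : ℕ) {m m' : ℕ} (h : m ≤ m') {p : ℝ} (h0 : 0 ≤ p)
    (h1 : p ≤ 1) : binomialTail N m p ≤ binomialTail N m' p := by
  have : 0 ≤ 1 - p := by linarith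
  exact Finset.sum_le_sum_of_subset_of_nonneg (Finset.range_mono h) fun r _ _ => by positivity

theorem binomialTail_full (N : ℕ) (p : ℝ) : binomialTail N (N + 1) p = 1 := by
  have h := add_pow (1 - p) p N
  rw [sub_add_cancel, one_pow] at h
  rw [h, binomialTail]
  exact Finset.sum_congr rfl fun r _ => by ring

theorem binomialTail_le_one (N : ℕ) {m : ℕ} (hm : m ≤ N + 1) {p : ℝ} (h0 : 0 ≤ p)
    (h1 : p ≤ 1) : binomialTail N m p ≤ 1 :=
  binomialTail_full N p ▸ binomialTail_mono_size N hm h0 h1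

theorem binomialTail_one (N : ℕ) (m : ℕ) : binomialTail N (m + 1) 1 = 1 := by
  rw [binomialTail, Finset.sum_range_succ']
  simp

theorem binomialTail_zero (N : ℕ) {m : ℕ} (hm : m ≤ N) : binomialTail N m 0 = 0 := by
  refine Finset.sum_eq_zero fun r hr => ?_
  have : r < m := Finset.mem_range.mp hr
  rw [zero_pow (by omega)]
  simp

theorem choose_mul_sub_cast (N s : ℕ) (hs : s ≤ N) :
    (N.choose s : ℝ) * ((N : ℝ) - s) = (s + 1) * N.choose (s + 1) := by
  have h := Nat.choose_succ_right_eq N s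
  have h' : ((N.choose (s + 1) * (s + 1) : ℕ) : ℝ) = (N.choose s * (N - s) : ℕ) := by rw [h]
  push_cast [Nat.cast_sub hs] at h'
  linarith

/-- The sum telescopes: the negative part of the derivative of each term cancels the derivative of
the tail before it, so only the positive part of the last term survives. -/
theorem hasDerivAt_binomialTail (N : ℕ) {s : ℕ} (hs : s ≤ N) (p : ℝ) :
    HasDerivAt (binomialTail N (s + 1))
      ((s + 1) * N.choose (s + 1) * p ^ (N - (s + 1)) * (1 - p) ^ s) p := by
  have hq : HasDerivAt (fun p : ℝ => 1 - p) (-1) p := by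
    simpa using (hasDerivAt_id p).const_sub 1
  have key : ∀ r, HasDerivAt (fun p : ℝ => (N.choose r : ℝ) * p ^ (N - r) * (1 - p) ^ r)
      (N.choose r * ((N - r : ℕ) * p ^ (N - r - 1)) * (1 - p) ^ r
        + N.choose r * p ^ (N - r) * (r * (1 - p) ^ (r - 1) * (-1))) p := fun r =>
    ((hasDerivAt_pow (N - r) p).const_mul _).mul (hq.pow r)
  induction s with
  | zero =>
    have h := key 0
    have e : binomialTail N (0 + 1) = fun p : ℝ => (N.choose 0 : ℝ) * p ^ (N - 0) * (1 - p) ^ 0 := by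
      funext x
      simp [binomialTail]
    rw [e]
    refine h.congr_deriv ?_
    simp
  | succ s ih =>
    have e : binomialTail N (s + 1 + 1) = fun x => binomialTail N (s + 1) x
        + (N.choose (s + 1) : ℝ) * x ^ (N - (s + 1)) * (1 - x) ^ (s + 1) := by
      funext x
      rw [binomialTail, Finset.sum_range_succ, binomialTail]
    rw [e]
    refine ((ih (by omega)).add (key (s + 1))).congr_deriv ?_
    have h := choose_mul_sub_cast N (s + 1) hs
    rw [Nat.cast_sub hs, Nat.sub_sub]
    push_cast at h ⊢
    linear_combination (p ^ (N - (s + 1 + 1)) * (1 - p) ^ (s + 1)) * h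

theorem binomialTail_monotoneOn (N : ℕ) {m : ℕ} (hm : m ≤ N + 1) :
    MonotoneOn (binomialTail N m) (Set.Icc 0 1) := by
  cases m with
  | zero => intro x _ y _ _; simp [binomialTail]
  | succ s =>
    refine monotoneOn_of_deriv_nonneg (convex_Icc 0 1) (continuous_binomialTail _ _).continuousOn
      (fun p _ => (hasDerivAt_binomialTail N (by omega) p).differentiableAt.differentiableWithinAt)
      fun p hp => ?_
    rw [interior_Icc] at hp
    rw [(hasDerivAt_binomialTail N (by omega) p).deriv]
    have h1 : 0 ≤ 1 - p := by linarith [hp.2]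
    have h0 := hp.1.le
    positivity

/-- A Bernstein term of degree N has as primitive a tail of degree N + 1, divided by N + 1, by the
derivative formula above. -/
theorem integral_bernstein_from (N : ℕ) {r : ℕ} (hr : r ≤ N) (a : ℝ) :
    ∫ p in a..1, (N.choose r : ℝ) * p ^ (N - r) * (1 - p) ^ r
      = (1 - binomialTail (N + 1) (r + 1) a) / (N + 1) := by
  have h : ∀ p ∈ Set.uIcc a 1, HasDerivAt (fun x => binomialTail (N + 1) (r + 1) x / (N + 1))
      ((N.choose r : ℝ) * p ^ (N - r) * (1 - p) ^ r) p := by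
    intro p _
    refine ((hasDerivAt_binomialTail (N + 1) (s := r) (by omega) p).div_const ((N : ℝ) + 1)).congr_deriv ?_
    have h1 : ((N + 1 : ℕ) * N.choose r : ℕ) = (N + 1).choose (r + 1) * (r + 1) :=
      Nat.add_one_mul_choose_eq N r
    have h2 : ((N : ℝ) + 1) * N.choose r = (N + 1).choose (r + 1) * (r + 1) := by exact_mod_cast h1
    rw [Nat.add_sub_add_right]
    field_simp
    linear_combination (-(p ^ (N - r) * (1 - p) ^ r)) * h2
  rw [intervalIntegral.integral_eq_sub_of_hasDerivAt h
    (Continuous.intervalIntegrable (by fun_prop) _ _), binomialTail_one]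
  ring

theorem integral_bernstein (N : ℕ) {r : ℕ} (hr : r ≤ N) :
    ∫ p in (0 : ℝ)..1, (N.choose r : ℝ) * p ^ (N - r) * (1 - p) ^ r = 1 / (N + 1) := by
  rw [integral_bernstein_from N hr, binomialTail_zero _ (by omega), sub_zero]

theorem integral_binomialTail (N : ℕ) {m : ℕ} (hm : m ≤ N + 1) :
    ∫ p in (0 : ℝ)..1, binomialTail N m p = m / (N + 1) := by
  unfold binomialTail
  rw [intervalIntegral.integral_finsetSum fun r _ => Continuous.intervalIntegrable (by fun_prop) _ _]
  rw [Finset.sum_congr rfl fun r hr => integral_bernstein N (by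
    have := Finset.mem_range.mp hr; omega)]
  simp [div_eq_mul_inv]

/-! ### The upper tail of the admission probability -/

/-- The probability that an opponent drawn at random is admitted and has an ability quantile
above `p`. -/
noncomputable def upperTail (N m : ℕ) (p : ℝ) : ℝ := ∫ x in p..1, binomialTail N m x

theorem upperTail_nonneg (N m : ℕ) {p : ℝ} (h0 : 0 ≤ p) (h1 : p ≤ 1) : 0 ≤ upperTail N m p :=
  intervalIntegral.integral_nonneg h1 fun _ hx =>
    binomialTail_nonneg N m (h0.trans hx.1) hx.2

theorem upperTail_le (N : ℕ) {m : ℕ} (hm : m ≤ N + 1) {p : ℝ} (h0 : 0 ≤ p) (h1 : p ≤ 1) :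
    upperTail N m p ≤ 1 - p := by
  have h := intervalIntegral.integral_mono_on (μ := volume) h1
    ((continuous_binomialTail N m).intervalIntegrable _ _)
    ((continuous_const (y := (1 : ℝ))).intervalIntegrable _ _)
    fun _ hx => binomialTail_le_one N hm (h0.trans hx.1) hx.2
  rwa [intervalIntegral.integral_const, smul_eq_mul, mul_one] at h

theorem upperTail_full (N : ℕ) (p : ℝ) : upperTail N (N + 1) p = 1 - p := by
  simp [upperTail, binomialTail_full]

/-- The tail is nondecreasing in p, so [1/2, 1] carries at least half of its total integral m/(N +
1). -/
theorem upperTail_lower (N : ℕ) {m : ℕ} (hm : m ≤ N + 1) {p : ℝ} (h0 : 0 ≤ p) (h1 : p ≤ 1 / 2) :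
    (m : ℝ) / (2 * (N + 1)) ≤ upperTail N m p := by
  have hi : ∀ a b, IntervalIntegrable (binomialTail N m) volume a b := fun a b =>
    (continuous_binomialTail N m).intervalIntegrable a b
  have hmono := binomialTail_monotoneOn N hm
  have e1 : ∫ x in (0 : ℝ)..(1 / 2), binomialTail N m x ≤ ∫ _ in (0 : ℝ)..(1 / 2), binomialTail N m (1 / 2) :=
    intervalIntegral.integral_mono_on (by norm_num) (hi _ _)
      (continuous_const.intervalIntegrable _ _) fun x hx =>
      hmono ⟨hx.1, by linarith [hx.2]⟩ ⟨by norm_num, by norm_num⟩ hx.2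
  have e2 : ∫ _ in (1 / 2 : ℝ)..1, binomialTail N m (1 / 2) ≤ ∫ x in (1 / 2 : ℝ)..1, binomialTail N m x :=
    intervalIntegral.integral_mono_on (by norm_num) (continuous_const.intervalIntegrable _ _)
      (hi _ _) fun x hx =>
      hmono ⟨by norm_num, by norm_num⟩ ⟨by linarith [hx.1], hx.2⟩ hx.1
  have e3 := intervalIntegral.integral_add_adjacent_intervals (hi 0 (1 / 2)) (hi (1 / 2) 1)
  have e4 := intervalIntegral.integral_add_adjacent_intervals (hi p (1 / 2)) (hi (1 / 2) 1)
  have e5 : 0 ≤ ∫ x in p..(1 / 2), binomialTail N m x :=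
    intervalIntegral.integral_nonneg h1 fun x hx =>
      binomialTail_nonneg N m (h0.trans hx.1) (by linarith [hx.2])
  rw [integral_binomialTail N hm] at e3
  rw [intervalIntegral.integral_const, smul_eq_mul] at e1 e2
  have : (m : ℝ) / (2 * (N + 1)) = m / (N + 1) / 2 := by field_simp
  rw [this, upperTail]
  linarith

/-! ### Bounds on the rank density relative to the admission probability -/

/-- The derivative of `binomialTail N l`, in the form in which it enters the equilibrium effort. -/
noncomputable def rankDensity (N l : ℕ) (p : ℝ) : ℝ :=
  l * N.choose l * p ^ (N - l) * (1 - p) ^ (l - 1)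

theorem continuous_rankDensity (N l : ℕ) : Continuous (rankDensity N l) := by
  unfold rankDensity
  fun_prop

theorem rankDensity_nonneg (N l : ℕ) {p : ℝ} (h0 : 0 ≤ p) (h1 : p ≤ 1) :
    0 ≤ rankDensity N l p := by
  have : 0 ≤ 1 - p := by linarith
  unfold rankDensity
  positivity

theorem rankDensity_mul (N : ℕ) {l : ℕ} (hl : 1 ≤ l) (p : ℝ) :
    rankDensity N l p * (1 - p) = l * (N.choose l * p ^ (N - l) * (1 - p) ^ l) := by
  obtain ⟨s, rfl⟩ : ∃ s, l = s + 1 := ⟨l - 1, by omega⟩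
  rw [rankDensity, Nat.add_sub_cancel]
  ring

theorem rankDensity_mul_le (N : ℕ) {l m : ℕ} (hl : 1 ≤ l) (hm : l < m) {p : ℝ} (h0 : 0 ≤ p)
    (h1 : p ≤ 1) : rankDensity N l p * (1 - p) ≤ l * binomialTail N m p := by
  rw [rankDensity_mul N hl]
  have : 0 ≤ 1 - p := by linarith
  gcongr
  exact Finset.single_le_sum (f := fun r => (N.choose r : ℝ) * p ^ (N - r) * (1 - p) ^ r)
    (fun r _ => by positivity) (Finset.mem_range.mpr hm)

/-- Replacing the upper tail by 1 - p makes the numerator l times a single term of the tail in the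
denominator. This is the pointwise source of the linear upper bound for all contests. -/
theorem rankDensity_div_mul_upperTail_le (N : ℕ) {l m : ℕ} (hl : 1 ≤ l) (hm : l < m)
    (hmN : m ≤ N + 1) {p : ℝ} (h0 : 0 ≤ p) (h1 : p ≤ 1) :
    rankDensity N l p / binomialTail N m p * upperTail N m p ≤ l := by
  have hJ := binomialTail_nonneg N m h0 h1
  have hd := rankDensity_nonneg N l h0 h1
  calc _ ≤ rankDensity N l p / binomialTail N m p * (1 - p) := by
        gcongr
        exact upperTail_le N hmN h0 h1
    _ = rankDensity N l p * (1 - p) / binomialTail N m p := by ring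
    _ ≤ l := div_le_of_le_mul₀ hJ (by positivity) (rankDensity_mul_le N hl hm h0 h1)

/-- A crude bound, needed only for integrability. For p ≤ 1/2 the factor 1 - p is at least 1/2 and
the previous estimate applies; for p ≥ 1/2 the denominator is at least p^N ≥ 2^(-N). -/
theorem rankDensity_le_const_mul (N : ℕ) {l m : ℕ} (hl : 1 ≤ l) (hm : l < m) {p : ℝ}
    (h0 : 0 ≤ p) (h1 : p ≤ 1) :
    rankDensity N l p / binomialTail N m p ≤ l * N.choose l * 2 ^ N + 2 * l := by
  have hJ := binomialTail_nonneg N m h0 h1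
  have hq : 0 ≤ 1 - p := by linarith
  refine div_le_of_le_mul₀ hJ (by positivity) ?_
  rcases le_total p (1 / 2) with h | h
  · have h2 := rankDensity_mul_le N hl hm h0 h1
    have h3 := rankDensity_nonneg N l h0 h1
    have h4 : 0 ≤ (l * N.choose l * 2 ^ N : ℝ) * binomialTail N m p := by positivity
    nlinarith
  · have h2 : rankDensity N l p ≤ l * N.choose l := by
      unfold rankDensity
      have a1 : p ^ (N - l) ≤ 1 := pow_le_one₀ h0 h1
      have a2 : (1 - p) ^ (l - 1) ≤ 1 := pow_le_one₀ hq (by linarith)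
      calc _ ≤ (l * N.choose l : ℝ) * 1 * 1 := by gcongr
        _ = _ := by ring
    have h3 : (1 / 2 : ℝ) ^ N ≤ binomialTail N m p := by
      calc (1 / 2 : ℝ) ^ N ≤ p ^ N := by gcongr
        _ = binomialTail N 1 p := by simp [binomialTail]
        _ ≤ _ := binomialTail_mono_size N (by omega) h0 h1
    have h4 : (1 : ℝ) ≤ 2 ^ N * binomialTail N m p := by
      calc (1 : ℝ) = 2 ^ N * (1 / 2) ^ N := by rw [← mul_pow]; norm_num
        _ ≤ _ := by gcongr
    calc rankDensity N l p ≤ l * N.choose l * 1 := by rw [mul_one]; exact h2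
      _ ≤ l * N.choose l * (2 ^ N * binomialTail N m p) := by gcongr
      _ ≤ _ := by
        have : 0 ≤ 2 * l * binomialTail N m p := by positivity
        linarith

/-- Below the mode, a binomial tail is at most twice its last term. -/
theorem binomialTail_le_two_mul (N : ℕ) {l : ℕ} (hl : 3 * l ≤ N + 1) {p : ℝ} (h0 : 0 ≤ p)
    (h1 : p ≤ 1 / 2) :
    binomialTail N (l + 1) p ≤ 2 * (N.choose l * p ^ (N - l) * (1 - p) ^ l) := by
  have hq : 0 ≤ 1 - p := by linarith
  induction l with
  | zero =>
    have : 0 ≤ p ^ N := by positivity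
    simp [binomialTail]
    linarith
  | succ l ih =>
    have e : binomialTail N (l + 1 + 1) p = binomialTail N (l + 1) p
        + (N.choose (l + 1) : ℝ) * p ^ (N - (l + 1)) * (1 - p) ^ (l + 1) := by
      rw [binomialTail, Finset.sum_range_succ, binomialTail]
    have ih := ih (by omega)
    rw [e]
    -- The condition 3(l + 1) ≤ N + 1 says that (N - l)/(l + 1) ≥ 2, so each coefficient is at least
    -- twice the preceding one.
    have hc : 2 * (N.choose l : ℝ) ≤ N.choose (l + 1) := by
      have h := Nat.choose_succ_right_eq N l
      have : 2 * N.choose l ≤ N.choose (l + 1) := by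
        have h2 : N.choose l * (2 * (l + 1)) ≤ N.choose (l + 1) * (l + 1) := by
          rw [h]
          exact Nat.mul_le_mul_left _ (by omega)
        have h3 : (2 * N.choose l) * (l + 1) ≤ N.choose (l + 1) * (l + 1) := by
          calc _ = N.choose l * (2 * (l + 1)) := by ring
            _ ≤ _ := h2
        exact Nat.le_of_mul_le_mul_right h3 (by omega)
      exact_mod_cast this
    have hp : p ^ (N - l) * (1 - p) ^ l ≤ p ^ (N - (l + 1)) * (1 - p) ^ (l + 1) := by
      have e1 : N - l = N - (l + 1) + 1 := by omega
      rw [e1, pow_succ, pow_succ]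
      have : 0 ≤ p ^ (N - (l + 1)) * (1 - p) ^ l := by positivity
      nlinarith
    have : 2 * (N.choose l : ℝ) * (p ^ (N - l) * (1 - p) ^ l)
        ≤ N.choose (l + 1) * (p ^ (N - (l + 1)) * (1 - p) ^ (l + 1)) := by gcongr
    nlinarith

/-- The tail is at most twice its last term, and l times that last term equals the density times 1 -
p ≤ 1. -/
theorem rankDensity_div_lower (N : ℕ) {l : ℕ} (hl : 1 ≤ l) (hl3 : 3 * l ≤ N + 1) {p : ℝ}
    (h0 : 0 < p) (h1 : p ≤ 1 / 2) :
    (l : ℝ) / 2 ≤ rankDensity N l p / binomialTail N (l + 1) p := by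
  have hq : 0 < 1 - p := by linarith
  have hJ : 0 < binomialTail N (l + 1) p := by
    refine lt_of_lt_of_le (b := binomialTail N 1 p) ?_
      (binomialTail_mono_size N (by omega) h0.le (by linarith))
    simp only [binomialTail, Finset.range_one, Finset.sum_singleton, Nat.choose_zero_right]
    simp only [Nat.cast_one, one_mul, pow_zero, mul_one]
    positivity
  rw [le_div_iff₀ hJ]
  have h2 := binomialTail_le_two_mul N hl3 h0.le h1
  have h3 := rankDensity_mul N hl p
  have h4 := rankDensity_nonneg N l h0.le (by linarith : p ≤ 1)
  calc (l : ℝ) / 2 * binomialTail N (l + 1) p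
      ≤ (l : ℝ) / 2 * (2 * (N.choose l * p ^ (N - l) * (1 - p) ^ l)) := by gcongr
    _ = rankDensity N l p * (1 - p) := by rw [h3]; ring
    _ ≤ rankDensity N l p := by nlinarith

/-- Abel summation; the discarded boundary term is (m + 1) V_{m+1} ≥ 0. -/
theorem sum_mul_prize_drop_le (V : ℕ → ℝ) (m : ℕ) (hV : ∀ l ∈ Set.Icc 1 (m + 1), 0 ≤ V l) :
    ∑ l ∈ Finset.Icc 1 m, (V l - V (l + 1)) * l ≤ ∑ l ∈ Finset.Icc 1 (m + 1), V l := by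
  have h : ∀ m : ℕ, ∑ l ∈ Finset.Icc 1 m, (V l - V (l + 1)) * l
      = ∑ l ∈ Finset.Icc 1 (m + 1), V l - (m + 1) * V (m + 1) := by
    intro m
    induction m with
    | zero => simp
    | succ m ih =>
      rw [Finset.sum_Icc_succ_top (by omega), ih, Finset.sum_Icc_succ_top (b := m + 1) (by omega)]
      push_cast
      ring
  rw [h m]
  have := hV (m + 1) ⟨by omega, le_rfl⟩
  nlinarith [mul_nonneg (by positivity : (0 : ℝ) ≤ (m : ℝ) + 1) this]

/-! ### The ability law and the quantile change of variables -/

namespace AbilityDistribution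

variable (D : AbilityDistribution)

theorem integrable_f : Integrable D.f := by
  by_contra h
  have h1 := D.integral_f
  rw [integral_undef h] at h1
  exact zero_ne_one h1

theorem integral_law (g : ℝ → ℝ) : ∫ x, g x ∂D.law = ∫ x, D.f x * g x := by
  rw [law, integral_withDensity_eq_integral_toReal_smul₀
    D.integrable_f.aestronglyMeasurable.aemeasurable.ennreal_ofReal
    (Filter.Eventually.of_forall fun _ => ENNReal.ofReal_lt_top)]
  simp [ENNReal.toReal_ofReal (D.f_nonneg _)]

theorem setIntegral_law (g : ℝ → ℝ) {s : Set ℝ} (hs : MeasurableSet s) :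
    ∫ x in s, g x ∂D.law = ∫ x in s, D.f x * g x := by
  rw [← integral_indicator hs, integral_law, ← integral_indicator hs]
  refine integral_congr_ae (Filter.Eventually.of_forall fun x => ?_)
  by_cases h : x ∈ s <;> simp [h]

theorem ae_mem_Ioo : ∀ᵐ x ∂D.law, x ∈ Set.Ioo D.lo D.hi := by
  have h : D.law (Set.Ioo D.lo D.hi)ᶜ = 0 := by
    rw [law, withDensity_apply _ measurableSet_Ioo.compl, lintegral_eq_zero_iff'
      D.integrable_f.aestronglyMeasurable.aemeasurable.ennreal_ofReal.restrict]
    -- The density is not required to vanish at the two endpoints, so they are removed as a null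
    -- set.
    have h2 : ∀ᵐ x : ℝ, x ∉ ({D.lo, D.hi} : Set ℝ) :=
      measure_eq_zero_iff_ae_notMem.mp ((Set.toFinite _).measure_zero volume)
    filter_upwards [ae_restrict_mem measurableSet_Ioo.compl, ae_restrict_of_ae h2] with x hx hx2
    rw [D.f_eq_zero x]
    · simp
    · intro hx3
      simp only [Set.mem_insert_iff, Set.mem_singleton_iff, not_or] at hx2
      exact hx ⟨lt_of_le_of_ne hx3.1 (Ne.symm hx2.1), lt_of_le_of_ne hx3.2 hx2.2⟩
  exact measure_eq_zero_iff_ae_notMem.mp h |>.mono fun x hx => not_not.mp hx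

theorem measureReal_Iic (t : ℝ) : D.law.real (Set.Iic t) = D.F t := (cdf_eq_real _ t).symm

theorem measureReal_Ioi (t : ℝ) : D.law.real (Set.Ioi t) = 1 - D.F t := by
  rw [← Set.compl_Iic, measureReal_compl measurableSet_Iic, measureReal_Iic, probReal_univ]

theorem F_nonneg (t : ℝ) : 0 ≤ D.F t := cdf_nonneg _ t

theorem F_le_one (t : ℝ) : D.F t ≤ 1 := cdf_le_one _ t

theorem monotone_F : Monotone D.F := monotone_cdf _

theorem F_eq_integral (t : ℝ) : D.F t = ∫ x in Set.Iic t, D.f x := by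
  have h := D.setIntegral_law (fun _ => 1) (measurableSet_Iic (a := t))
  rw [setIntegral_const, measureReal_Iic] at h
  simpa using h

theorem F_sub_F (a b : ℝ) : D.F b - D.F a = ∫ x in a..b, D.f x := by
  rw [F_eq_integral, F_eq_integral]
  exact intervalIntegral.integral_Iic_sub_Iic D.integrable_f.integrableOn D.integrable_f.integrableOn

theorem F_eq_add (t : ℝ) : D.F t = D.F 0 + ∫ x in (0 : ℝ)..t, D.f x := by
  linarith [D.F_sub_F 0 t]

theorem continuous_F : Continuous D.F := by
  rw [funext D.F_eq_add]
  exact continuous_const.add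
    (intervalIntegral.continuous_primitive (fun a b => D.integrable_f.intervalIntegrable) 0)

theorem hasDerivAt_F {t : ℝ} (ht : t ∈ Set.Ioo D.lo D.hi) : HasDerivAt D.F (D.f t) t := by
  rw [funext D.F_eq_add]
  refine HasDerivAt.const_add _ ?_
  exact intervalIntegral.integral_hasDerivAt_right D.integrable_f.intervalIntegrable
    (D.integrable_f.aestronglyMeasurable.stronglyMeasurableAtFilter)
    (D.f_continuousOn.continuousAt (Ioo_mem_nhds ht.1 ht.2))

theorem F_lo : D.F D.lo = 0 := by
  rw [← measureReal_Iic, measureReal_def, measure_eq_zero_iff_ae_notMem.mpr, ENNReal.toReal_zero]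
  filter_upwards [D.ae_mem_Ioo] with x hx h
  exact absurd hx.1 (not_lt.mpr h)

theorem F_hi : D.F D.hi = 1 := by
  have h : D.law.real (Set.Ioi D.hi) = 0 := by
    rw [measureReal_def, measure_eq_zero_iff_ae_notMem.mpr, ENNReal.toReal_zero]
    filter_upwards [D.ae_mem_Ioo] with x hx h
    exact absurd hx.2 (not_lt.mpr (le_of_lt h))
  rw [measureReal_Ioi] at h
  linarith

theorem exists_F_eq {p : ℝ} (hp : p ∈ Set.Icc (0 : ℝ) 1) : ∃ t ∈ Set.Icc D.lo D.hi, D.F t = p := by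
  have h := intermediate_value_Icc D.lo_lt_hi.le D.continuous_F.continuousOn
  rw [F_lo, F_hi] at h
  exact h hp

/-- Change of variables to the quantile scale. -/
theorem setIntegral_comp_F {g : ℝ → ℝ} (hg : Continuous g) {a b : ℝ} (ha : D.lo ≤ a)
    (hab : a ≤ b) (hb : b ≤ D.hi) :
    ∫ x in Set.Ioc a b, g (D.F x) ∂D.law = ∫ p in D.F a..D.F b, g p := by
  have hgF : Continuous (g ∘ D.F) := hg.comp D.continuous_F
  -- The density may be unbounded near the endpoints, so the substitution uses derivatives in the
  -- interior only, together with integrability of f.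
  have hd : ∀ x ∈ Set.Ioo (min a b) (max a b), HasDerivWithinAt D.F (D.f x) (Set.Ioi x) x := by
    intro x hx
    rw [min_eq_left hab, max_eq_right hab] at hx
    exact (D.hasDerivAt_F ⟨ha.trans_lt hx.1, hx.2.trans_le hb⟩).hasDerivWithinAt
  rw [D.setIntegral_law _ measurableSet_Ioc, ← intervalIntegral.integral_of_le hab,
    ← intervalIntegral.integral_comp_mul_deriv''' D.continuous_F.continuousOn hd hg.continuousOn
      (hg.continuousOn.integrableOn_compact (isCompact_uIcc.image D.continuous_F))
      (D.integrable_f.integrableOn.continuousOn_mul hgF.continuousOn isCompact_uIcc)]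
  exact intervalIntegral.integral_congr fun x _ => mul_comm _ _

theorem integral_comp_F {g : ℝ → ℝ} (hg : Continuous g) :
    ∫ x, g (D.F x) ∂D.law = ∫ p in (0 : ℝ)..1, g p := by
  rw [← D.F_lo, ← D.F_hi, ← D.setIntegral_comp_F hg le_rfl D.lo_lt_hi.le le_rfl]
  symm
  apply setIntegral_eq_integral_of_ae_compl_eq_zero
  filter_upwards [D.ae_mem_Ioo] with x hx h
  exact absurd (Set.Ioo_subset_Ioc_self hx) h

theorem setIntegral_Ioi_comp_F {g : ℝ → ℝ} (hg : Continuous g) {t : ℝ}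
    (ht : t ∈ Set.Ioo D.lo D.hi) :
    ∫ x in Set.Ioi t, g (D.F x) ∂D.law = ∫ p in D.F t..1, g p := by
  rw [← D.F_hi, ← D.setIntegral_comp_F hg ht.1.le ht.2.le le_rfl]
  apply setIntegral_congr_set
  filter_upwards [D.ae_mem_Ioo] with x hx
  exact propext ⟨fun h => ⟨h, hx.2.le⟩, fun h => h.1⟩

end AbilityDistribution

namespace AbilityDistribution

variable (D : AbilityDistribution)

theorem ae_ne (t : ℝ) : ∀ᵐ x ∂D.law, x ≠ t :=
  (withDensity_absolutelyContinuous volume _).ae_le (Measure.ae_ne volume t)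

theorem setIntegral_Ici_comp_F {g : ℝ → ℝ} (hg : Continuous g) {t : ℝ}
    (ht : t ∈ Set.Ioo D.lo D.hi) :
    ∫ x in Set.Ici t, g (D.F x) ∂D.law = ∫ p in D.F t..1, g p := by
  rw [← D.setIntegral_Ioi_comp_F hg ht]
  apply setIntegral_congr_set
  filter_upwards [D.ae_ne t] with x hx
  exact propext ⟨fun h => lt_of_le_of_ne h (Ne.symm hx), fun h => le_of_lt h⟩

theorem measureReal_Ioc {a b : ℝ} (hab : a ≤ b) :
    D.law.real (Set.Ioc a b) = D.F b - D.F a := by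
  have h : Set.Ioc a b = Set.Iic b \ Set.Iic a := by
    ext
    simp [and_comm]
  rw [h, measureReal_sdiff (Set.Iic_subset_Iic.mpr hab) measurableSet_Iic,
    measureReal_Iic, measureReal_Iic]

/-! ### Integrating out the opponents -/

open Classical in
/-- The number of coordinates above a threshold is binomially distributed. -/
theorem integral_card_lt (N m : ℕ) (hm : m ≤ N + 1) (x : ℝ) :
    ∫ y : Fin N → ℝ, (if (Finset.univ.filter fun j => x < y j).card < m then (1 : ℝ) else 0)
      ∂(Measure.pi fun _ => D.law) = binomialTail N m (D.F x) := by
  let w : ℕ → ℝ := fun r => if r < m then 1 else 0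
  -- The product over j of these indicators is the indicator that S is exactly the set of
  -- coordinates above x, so expectations factor by independence.
  let φ : Finset (Fin N) → Fin N → ℝ → ℝ := fun S j =>
    if j ∈ S then (Set.Ioi x).indicator 1 else (Set.Iic x).indicator 1
  have hφ : ∀ S j, Integrable (φ S j) D.law := by
    intro S j
    by_cases h : j ∈ S
    · simp only [φ, h, if_true]
      exact (integrable_const (1 : ℝ)).indicator measurableSet_Ioi
    · simp only [φ, h, if_false]
      exact (integrable_const (1 : ℝ)).indicator measurableSet_Iic
  have hφi : ∀ S j, ∫ t, φ S j t ∂D.law = if j ∈ S then 1 - D.F x else D.F x := by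
    intro S j
    by_cases h : j ∈ S
    · simp only [φ, h, if_true]
      rw [integral_indicator_one measurableSet_Ioi, measureReal_Ioi]
    · simp only [φ, h, if_false]
      rw [integral_indicator_one measurableSet_Iic, measureReal_Iic]
  have hprod : ∀ (S : Finset (Fin N)) (y : Fin N → ℝ), ∏ j, φ S j (y j)
      = if (Finset.univ.filter fun j => x < y j) = S then 1 else 0 := by
    intro S y
    have hj : ∀ j, φ S j (y j) = if (x < y j ↔ j ∈ S) then 1 else 0 := by
      intro j
      by_cases h : j ∈ S <;> by_cases h' : x < y j <;>
        simp [φ, h, h', not_le.mpr, Set.indicator, not_lt.mp]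
    simp_rw [hj]
    rw [Finset.prod_ite_zero]
    simp [Finset.ext_iff]
  have hsum : ∀ y : Fin N → ℝ,
      (if (Finset.univ.filter fun j => x < y j).card < m then (1 : ℝ) else 0)
        = ∑ S : Finset (Fin N), w S.card * ∏ j, φ S j (y j) := by
    intro y
    simp_rw [hprod]
    simp [w]
  simp_rw [hsum]
  rw [integral_finsetSum _ fun S _ => (Integrable.fintype_prod fun j => hφ S j).const_mul _]
  have hterm : ∀ S : Finset (Fin N), ∫ y : Fin N → ℝ, w S.card * ∏ j, φ S j (y j)
      ∂(Measure.pi fun _ => D.law)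
      = w S.card * ((1 - D.F x) ^ S.card * D.F x ^ (N - S.card)) := by
    intro S
    rw [integral_const_mul, integral_fintype_prod_eq_prod]
    simp_rw [hφi]
    rw [Finset.prod_ite, Finset.prod_const, Finset.prod_const, Finset.filter_not]
    simp [Finset.card_sdiff]
  simp_rw [hterm]
  rw [← Finset.powerset_univ,
    Finset.sum_powerset_apply_card fun r => w r * ((1 - D.F x) ^ r * D.F x ^ (N - r)),
    Finset.card_univ, Fintype.card_fin, binomialTail]
  rw [← Finset.sum_subset (Finset.range_mono hm)]
  · refine Finset.sum_congr rfl fun r hr => ?_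
    simp only [w, Finset.mem_range.mp hr, if_true, nsmul_eq_mul]
    ring
  · intro r _ hr
    simp only [Finset.mem_range] at hr
    simp [w, hr]

open Classical in
/-- Expected effort of one contestant: the opponents are integrated out. -/
theorem integral_admitted {N m : ℕ} (hm : m ≤ N + 1) {b : ℝ → ℝ} (hb : Integrable b D.law)
    (i : Fin (N + 1)) :
    Integrable (fun x : Fin (N + 1) → ℝ =>
      if (Finset.univ.filter fun j => x i < x j).card < m then b (x i) else 0)
      (Measure.pi fun _ => D.law) ∧
    ∫ x : Fin (N + 1) → ℝ,
      (if (Finset.univ.filter fun j => x i < x j).card < m then b (x i) else 0)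
      ∂(Measure.pi fun _ => D.law) = ∫ x, b x * binomialTail N m (D.F x) ∂D.law := by
  let g : ℝ × (Fin N → ℝ) → ℝ := fun z =>
    if (Finset.univ.filter fun j => z.1 < z.2 j).card < m then 1 else 0
  have hg : Measurable g := by
    refine Measurable.ite ?_ measurable_const measurable_const
    have hc : Measurable fun z : ℝ × (Fin N → ℝ) =>
        (Finset.univ.filter fun j => z.1 < z.2 j).card := by
      simp_rw [Finset.card_filter]
      refine Finset.measurable_sum _ fun j _ => Measurable.ite ?_ measurable_const measurable_const
      exact measurableSet_lt measurable_fst ((measurable_pi_apply j).comp measurable_snd)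
    exact hc (measurableSet_Iio (a := m))
  have mp := measurePreserving_piFinSuccAbove (fun _ : Fin (N + 1) => D.law) i
  have hint : Integrable (fun z : ℝ × (Fin N → ℝ) => b z.1 * g z)
      (D.law.prod (Measure.pi fun _ => D.law)) := by
    refine (hb.comp_fst _).mul_bdd (c := 1) hg.aestronglyMeasurable
      (Filter.Eventually.of_forall fun z => ?_)
    by_cases h : (Finset.univ.filter fun j => z.1 < z.2 j).card < m <;> simp [g, h]
  have heq : (fun x : Fin (N + 1) → ℝ =>
      if (Finset.univ.filter fun j => x i < x j).card < m then b (x i) else 0)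
      = (fun z : ℝ × (Fin N → ℝ) => b z.1 * g z) ∘
        (MeasurableEquiv.piFinSuccAbove (fun _ => ℝ) i) := by
    funext x
    -- The strict inequality keeps contestant i out of its own count, so only the N opponents
    -- matter.
    have hcard : (Finset.univ.filter fun j => x i < x j).card
        = (Finset.univ.filter fun j : Fin N => x i < x (i.succAbove j)).card := by
      rw [Finset.card_filter, Finset.card_filter, Fin.sum_univ_succAbove _ i]
      simp
    have hval : MeasurableEquiv.piFinSuccAbove (fun _ => ℝ) i x
        = (x i, fun j => x (i.succAbove j)) := rfl
    rw [Function.comp_apply, hval, hcard]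
    by_cases h : (Finset.univ.filter fun j : Fin N => x i < x (i.succAbove j)).card < m
    · simp only [g]
      rw [if_pos h, if_pos h, mul_one]
    · simp only [g]
      rw [if_neg h, if_neg h, mul_zero]
  constructor
  · rw [heq]
    exact mp.integrable_comp_of_integrable hint
  · rw [heq]
    refine (mp.integral_comp' fun z : ℝ × (Fin N → ℝ) => b z.1 * g z).trans ?_
    rw [integral_prod _ hint]
    refine integral_congr_ae (Filter.Eventually.of_forall fun x => ?_)
    simp only [g]
    rw [integral_const_mul, D.integral_card_lt N m hm x]

open Classical in
theorem integral_sum_admitted {N m : ℕ} (hm : m ≤ N + 1) {b : ℝ → ℝ} (hb : Integrable b D.law) :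
    ∫ x : Fin (N + 1) → ℝ, ∑ i,
      (if (Finset.univ.filter fun j => x i < x j).card < m then b (x i) else 0)
      ∂(Measure.pi fun _ => D.law)
      = (N + 1) * ∫ x, b x * binomialTail N m (D.F x) ∂D.law := by
  rw [integral_finsetSum _ fun i _ => (D.integral_admitted hm hb i).1]
  simp_rw [(D.integral_admitted hm hb _).2]
  simp

end AbilityDistribution

/-! ### Total effort as a single integral -/

/-- The marginal equilibrium effort, per unit of ability and density, as a function of the
ability quantile. -/
noncomputable def effortRate (N m : ℕ) (V : ℕ → ℝ) (p : ℝ) : ℝ :=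
  ∑ l ∈ Finset.Icc 1 (m - 1), (V l - V (l + 1)) * (rankDensity N l p / binomialTail N m p)

theorem admissionProb_eq (D : AbilityDistribution) (N m : ℕ) (t : ℝ) :
    admissionProb D (N + 1) m t = binomialTail N m (D.F t) := by
  unfold admissionProb binomialTail
  induction m with
  | zero => simp
  | succ m ih =>
    rw [Finset.sum_Icc_succ_top (by omega), Finset.sum_range_succ, ih]
    simp [Nat.add_sub_add_right]

theorem measurable_effortRate (N m : ℕ) (V : ℕ → ℝ) : Measurable (effortRate N m V) :=
  Finset.measurable_fun_sum _ fun l _ =>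
    ((continuous_rankDensity N l).measurable.div
      (continuous_binomialTail N m).measurable).const_mul _

theorem exists_abs_effortRate_le (N m : ℕ) (V : ℕ → ℝ) :
    ∃ C, ∀ p, 0 ≤ p → p ≤ 1 → |effortRate N m V p| ≤ C := by
  refine ⟨∑ l ∈ Finset.Icc 1 (m - 1), |V l - V (l + 1)| * (l * N.choose l * 2 ^ N + 2 * l),
    fun p h0 h1 => (Finset.abs_sum_le_sum_abs _ _).trans (Finset.sum_le_sum fun l hl => ?_)⟩
  have hl := Finset.mem_Icc.mp hl
  rw [abs_mul, abs_of_nonneg (div_nonneg (rankDensity_nonneg N l h0 h1)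
    (binomialTail_nonneg N m h0 h1))]
  gcongr
  exact rankDensity_le_const_mul N hl.1 (by omega) h0 h1

namespace AbilityDistribution

variable (D : AbilityDistribution)

theorem equilibriumEffort_eq (k : ℝ) {N m : ℕ} (hm : m ≤ N + 1) (V : ℕ → ℝ) {x : ℝ}
    (hx : x ∈ Set.Ioo D.lo D.hi) :
    equilibriumEffort D k (N + 1) m V x
      = k⁻¹ * ∫ t in Set.Iic x, effortRate N m V (D.F t) * t ∂D.law := by
  have h0 : 0 ≤ x := D.lo_nonneg.trans hx.1.le
  have h1 : ∫ t in Set.Iic x, effortRate N m V (D.F t) * t ∂D.law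
      = ∫ t in Set.Ioc 0 x, effortRate N m V (D.F t) * t ∂D.law := by
    -- Starting the effort integral at 0 loses nothing, since almost every ability exceeds lo ≥ 0.
    apply setIntegral_congr_set
    filter_upwards [D.ae_mem_Ioo] with t ht
    exact propext ⟨fun h => ⟨D.lo_nonneg.trans_lt ht.1, h⟩, fun h => h.2⟩
  rw [h1, D.setIntegral_law _ measurableSet_Ioc, ← intervalIntegral.integral_of_le h0,
    equilibriumEffort]
  congr 1
  refine intervalIntegral.integral_congr fun t _ => ?_
  rw [admissionProb_eq, effortRate, Finset.sum_div, ← mul_assoc, Finset.mul_sum]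
  congr 1
  refine Finset.sum_congr rfl fun l hl => ?_
  have hl := Finset.mem_Icc.mp hl
  obtain ⟨s, rfl⟩ : ∃ s, l = s + 1 := ⟨l - 1, by omega⟩
  have h2 := choose_mul_sub_cast N s (by omega)
  have e : N + 1 - (s + 1) - 1 = N - (s + 1) := by omega
  rw [e, rankDensity, Nat.add_sub_cancel, Nat.add_sub_cancel]
  push_cast
  rw [← mul_div_assoc, ← mul_div_assoc]
  congr 1
  linear_combination ((V (s + 1) - V (s + 1 + 1)) * D.F t ^ (N - (s + 1)) * (1 - D.F t) ^ s * D.f t)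
    * h2

theorem integrable_effortRate (N m : ℕ) (V : ℕ → ℝ) :
    Integrable (fun t => effortRate N m V (D.F t) * t) D.law := by
  obtain ⟨C, hC⟩ := exists_abs_effortRate_le N m V
  refine Integrable.of_bound (((measurable_effortRate N m V).comp
    D.continuous_F.measurable).mul measurable_id).aestronglyMeasurable (C * D.hi) ?_
  filter_upwards [D.ae_mem_Ioo] with t ht
  have h0 : 0 ≤ t := D.lo_nonneg.trans ht.1.le
  rw [norm_mul, Real.norm_eq_abs, Real.norm_eq_abs, abs_of_nonneg h0]
  have := hC _ (D.F_nonneg t) (D.F_le_one t)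
  have h2 : 0 ≤ C := (abs_nonneg _).trans this
  have := ht.2.le
  gcongr

/-- The total effort as a single integral over abilities. -/
theorem totalEffort_eq (k : ℝ) {N m : ℕ} (hm : m ≤ N + 1) (V : ℕ → ℝ) :
    totalEffort D k (N + 1) m V = k⁻¹ * ((N + 1) *
      ∫ t, t * (effortRate N m V (D.F t) * upperTail N m (D.F t)) ∂D.law) := by
  set h : ℝ → ℝ := fun t => effortRate N m V (D.F t) * t with hh
  have hint : Integrable h D.law := D.integrable_effortRate N m V
  -- The Fubini kernel: the marginal effort at t is exerted by every admitted ability x ≥ t.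
  -- Integrating over x first produces the upper tail at F(t).
  let K : ℝ × ℝ → ℝ := fun z => {z : ℝ × ℝ | z.2 ≤ z.1}.indicator (fun z => h z.2) z
  have hK : Integrable K (D.law.prod D.law) :=
    (hint.comp_snd D.law).indicator (measurableSet_le measurable_snd measurable_fst)
  have hinner : ∀ x, ∫ t, K (x, t) ∂D.law = ∫ t in Set.Iic x, h t ∂D.law := by
    intro x
    rw [← integral_indicator measurableSet_Iic]
    rfl
  have hb : (equilibriumEffort D k (N + 1) m V) =ᵐ[D.law] fun x => k⁻¹ * ∫ t, K (x, t) ∂D.law := by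
    filter_upwards [D.ae_mem_Ioo] with x hx
    rw [D.equilibriumEffort_eq k hm V hx, hinner]
  have hbi : Integrable (equilibriumEffort D k (N + 1) m V) D.law :=
    (integrable_congr hb).mpr (hK.integral_prod_left.const_mul _)
  have hJ : Continuous fun x => binomialTail N m (D.F x) :=
    (continuous_binomialTail N m).comp D.continuous_F
  have hKJ : Integrable (fun z : ℝ × ℝ => K z * binomialTail N m (D.F z.1)) (D.law.prod D.law) := by
    refine hK.mul_bdd (c := 1) (hJ.measurable.comp measurable_fst).aestronglyMeasurable
      (Filter.Eventually.of_forall fun z => ?_)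
    rw [Real.norm_eq_abs, abs_of_nonneg (binomialTail_nonneg N m (D.F_nonneg _) (D.F_le_one _))]
    exact binomialTail_le_one N hm (D.F_nonneg _) (D.F_le_one _)
  rw [totalEffort, D.integral_sum_admitted hm hbi]
  have e1 : ∫ x, equilibriumEffort D k (N + 1) m V x * binomialTail N m (D.F x) ∂D.law
      = k⁻¹ * ∫ x, ∫ t, K (x, t) * binomialTail N m (D.F x) ∂D.law ∂D.law := by
    rw [← integral_const_mul]
    refine integral_congr_ae ?_
    filter_upwards [hb] with x hx
    rw [hx, integral_mul_const, mul_assoc]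
  have e2 : ∫ t, ∫ x, K (x, t) * binomialTail N m (D.F x) ∂D.law ∂D.law
      = ∫ t, t * (effortRate N m V (D.F t) * upperTail N m (D.F t)) ∂D.law := by
    refine integral_congr_ae ?_
    filter_upwards [D.ae_mem_Ioo] with t ht
    have e3 : ∀ x, K (x, t) * binomialTail N m (D.F x)
        = h t * (Set.Ici t).indicator (fun x => binomialTail N m (D.F x)) x := by
      intro x
      by_cases hx : t ≤ x <;> simp [K, hx]
    simp_rw [e3]
    rw [integral_const_mul, integral_indicator measurableSet_Ici,
      D.setIntegral_Ici_comp_F (continuous_binomialTail N m) ht, upperTail, hh]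
    ring
  rw [e1, integral_integral_swap (f := fun x t => K (x, t) * binomialTail N m (D.F x)) hKJ, e2]
  ring

end AbilityDistribution

theorem continuous_upperTail (N m : ℕ) : Continuous (upperTail N m) := by
  have h : upperTail N m = fun p => -∫ x in (1 : ℝ)..p, binomialTail N m x := by
    funext p
    rw [upperTail, intervalIntegral.integral_symm]
  rw [h]
  exact (intervalIntegral.continuous_primitive
    (fun a b => (continuous_binomialTail N m).intervalIntegrable a b) 1).neg

theorem effortRate_mul_upperTail (N m : ℕ) (V : ℕ → ℝ) (p : ℝ) :
    effortRate N m V p * upperTail N m p = ∑ l ∈ Finset.Icc 1 (m - 1),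
      (V l - V (l + 1)) * (rankDensity N l p / binomialTail N m p * upperTail N m p) := by
  rw [effortRate, Finset.sum_mul]
  exact Finset.sum_congr rfl fun l _ => by ring

theorem effortRate_full_mul_upperTail (N : ℕ) (V : ℕ → ℝ) (p : ℝ) :
    effortRate N (N + 1) V p * upperTail N (N + 1) p = ∑ l ∈ Finset.Icc 1 N,
      (V l - V (l + 1)) * (l * (N.choose l * p ^ (N - l) * (1 - p) ^ l)) := by
  rw [effortRate_mul_upperTail]
  refine Finset.sum_congr rfl fun l hl => ?_
  rw [upperTail_full, binomialTail_full, div_one, rankDensity_mul N (Finset.mem_Icc.mp hl).1]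

theorem effortRate_simple (N : ℕ) {m l : ℕ} (hl : 1 ≤ l) (hm : l < m) (B p : ℝ) :
    effortRate N m (fun r => if r ≤ l then B / l else 0) p
      = B / l * (rankDensity N l p / binomialTail N m p) := by
  rw [effortRate, Finset.sum_eq_single l]
  · simp
  · intro r _ hr
    rcases lt_or_gt_of_ne hr with h | h
    · simp [h.le, Nat.succ_le_of_lt h]
    · simp [not_le.mpr h, not_le.mpr (h.trans (Nat.lt_succ_self r))]
  · intro h
    exact absurd (Finset.mem_Icc.mpr ⟨hl, by omega⟩) h

/-! ### Simple contests and the budget constraint -/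

namespace Contest

variable {B : ℝ} {n : ℕ}

/-- The simple contest: shortlist size `m` and `l` equal prizes. -/
noncomputable def simple (hB : 0 ≤ B) {m l : ℕ} (h2 : 2 ≤ m) (hm : m ≤ n) (hl : 1 ≤ l)
    (hlm : l ≤ m) : Contest B n where
  size := m
  two_le_size := h2
  size_le := hm
  prize := fun r => if r ≤ l then B / l else 0
  prize_antitone := by
    intro r _ s _ hrs
    have : 0 ≤ B / l := by positivity
    by_cases h : s ≤ l
    · simp [h, hrs.trans h]
    · by_cases h' : r ≤ l <;> simp [h, h', this]
  prize_nonneg := by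
    intro r _
    have : 0 ≤ B / l := by positivity
    by_cases h : r ≤ l <;> simp [h, this]
  budget := by
    rw [← Finset.sum_filter]
    have : (Finset.Icc 1 m).filter (· ≤ l) = Finset.Icc 1 l := by
      ext r
      simp only [Finset.mem_filter, Finset.mem_Icc]
      omega
    have hl' : (l : ℝ) ≠ 0 := by positivity
    rw [this, Finset.sum_const, Nat.card_Icc, Nat.add_sub_cancel, nsmul_eq_mul,
      mul_div_cancel₀ _ hl']

variable (C : Contest B n)

theorem drop_nonneg {l : ℕ} (hl : l ∈ Finset.Icc 1 (C.size - 1)) :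
    0 ≤ C.prize l - C.prize (l + 1) := by
  have h := Finset.mem_Icc.mp hl
  have := C.two_le_size
  exact sub_nonneg.mpr (C.prize_antitone ⟨h.1, by omega⟩ ⟨by omega, by omega⟩ (Nat.le_succ l))

theorem budget_nonneg (C : Contest B n) : 0 ≤ B :=
  (Finset.sum_nonneg fun l hl => C.prize_nonneg l (by simpa using hl)).trans C.budget

theorem sum_mul_drop_le :
    ∑ l ∈ Finset.Icc 1 (C.size - 1), (C.prize l - C.prize (l + 1)) * l ≤ B := by
  have h2 := C.two_le_size
  have e : C.size - 1 + 1 = C.size := by omega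
  have h := sum_mul_prize_drop_le C.prize (C.size - 1) (by rw [e]; exact C.prize_nonneg)
  rw [e] at h
  exact h.trans C.budget

theorem effortRate_nonneg (N : ℕ) {p : ℝ} (h0 : 0 ≤ p) (h1 : p ≤ 1) :
    0 ≤ effortRate N C.size C.prize p :=
  Finset.sum_nonneg fun l hl => mul_nonneg (C.drop_nonneg hl)
    (div_nonneg (rankDensity_nonneg N l h0 h1) (binomialTail_nonneg N _ h0 h1))

end Contest

/-! ### Upper and lower bounds on total effort -/

namespace AbilityDistribution

variable (D : AbilityDistribution)

theorem hi_pos : 0 < D.hi := D.lo_nonneg.trans_lt D.lo_lt_hi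

theorem integrable_effort (N : ℕ) {m : ℕ} (hm : m ≤ N + 1) (V : ℕ → ℝ) :
    Integrable (fun t => t * (effortRate N m V (D.F t) * upperTail N m (D.F t))) D.law := by
  have h := (D.integrable_effortRate N m V).mul_bdd (c := 1)
    ((continuous_upperTail N m).comp D.continuous_F).aestronglyMeasurable
    (Filter.Eventually.of_forall fun t => by
      have h0 := D.F_nonneg t
      have h1 := D.F_le_one t
      rw [Function.comp_apply, Real.norm_eq_abs, abs_of_nonneg (upperTail_nonneg N m h0 h1)]
      linarith [upperTail_le N hm h0 h1])
  refine h.congr (Filter.Eventually.of_forall fun t => ?_)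
  simp only [Function.comp_apply]
  ring

theorem effort_nonneg {B : ℝ} {n : ℕ} (C : Contest B n) (N : ℕ) :
    0 ≤ᵐ[D.law] fun t =>
      t * (effortRate N C.size C.prize (D.F t) * upperTail N C.size (D.F t)) := by
  filter_upwards [D.ae_mem_Ioo] with t ht
  exact mul_nonneg (D.lo_nonneg.trans ht.1.le)
    (mul_nonneg (C.effortRate_nonneg N (D.F_nonneg t) (D.F_le_one t))
      (upperTail_nonneg N _ (D.F_nonneg t) (D.F_le_one t)))

theorem TE_le {B : ℝ} {N : ℕ} (C : Contest B (N + 1)) {k : ℝ} (hk : 0 < k) :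
    C.TE D k ≤ (N + 1) * (D.hi * B / k) := by
  have h : ∫ t, t * (effortRate N C.size C.prize (D.F t) * upperTail N C.size (D.F t)) ∂D.law
      ≤ ∫ _, D.hi * B ∂D.law := by
    refine integral_mono_of_nonneg (D.effort_nonneg C N) (integrable_const _) ?_
    filter_upwards [D.ae_mem_Ioo] with t ht
    have hB := C.budget_nonneg
    have h1 : effortRate N C.size C.prize (D.F t) * upperTail N C.size (D.F t) ≤ B := by
      rw [effortRate_mul_upperTail]
      refine (Finset.sum_le_sum fun l hl => ?_).trans C.sum_mul_drop_le
      have hl' := Finset.mem_Icc.mp hl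
      have := C.two_le_size
      exact mul_le_mul_of_nonneg_left (rankDensity_div_mul_upperTail_le N hl'.1 (by omega)
        C.size_le (D.F_nonneg t) (D.F_le_one t)) (C.drop_nonneg hl)
    exact (mul_le_mul_of_nonneg_left h1 (D.lo_nonneg.trans ht.1.le)).trans
      (mul_le_mul_of_nonneg_right ht.2.le hB)
  rw [integral_const, probReal_univ, one_smul] at h
  rw [Contest.TE, D.totalEffort_eq k C.size_le]
  calc _ ≤ k⁻¹ * ((N + 1) * (D.hi * B)) := by gcongr
    _ = _ := by ring

/-- With everyone admitted, each prize drop multiplies l times a Bernstein term whose integral is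
1/(N + 1), cancelling the number of contestants. The pointwise bound behind `TE_le` would lose this
factor. -/
theorem TE_le_of_size_eq {B : ℝ} {N : ℕ} (C : Contest B (N + 1)) (hC : C.size = N + 1) {k : ℝ}
    (hk : 0 < k) : C.TE D k ≤ D.hi * B / k := by
  have hd := C.sum_mul_drop_le
  have hn := D.effort_nonneg C N
  have hdn := fun l hl => C.drop_nonneg (l := l) hl
  rw [Contest.TE, D.totalEffort_eq k C.size_le]
  rw [hC] at hd hn hdn ⊢
  rw [Nat.add_sub_cancel] at hd hdn
  simp_rw [effortRate_full_mul_upperTail] at hn ⊢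
  let g : ℝ → ℝ := fun p => D.hi * ∑ l ∈ Finset.Icc 1 N,
    (C.prize l - C.prize (l + 1)) * (l * (N.choose l * p ^ (N - l) * (1 - p) ^ l))
  have hg : Continuous g := by
    simp only [g]
    fun_prop
  have hgi : Integrable (fun t => g (D.F t)) D.law := by
    obtain ⟨c, hc⟩ := isCompact_Icc.exists_bound_of_continuousOn (s := Set.Icc (0 : ℝ) 1)
      hg.continuousOn
    exact Integrable.of_bound (hg.comp D.continuous_F).aestronglyMeasurable c
      (Filter.Eventually.of_forall fun t => hc _ ⟨D.F_nonneg t, D.F_le_one t⟩)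
  have h : ∫ t, t * ∑ l ∈ Finset.Icc 1 N, (C.prize l - C.prize (l + 1))
      * (l * (N.choose l * D.F t ^ (N - l) * (1 - D.F t) ^ l)) ∂D.law
      ≤ ∫ t, g (D.F t) ∂D.law := by
    refine integral_mono_of_nonneg hn hgi ?_
    filter_upwards [D.ae_mem_Ioo] with t ht
    refine mul_le_mul_of_nonneg_right ht.2.le (Finset.sum_nonneg fun l hl => ?_)
    have h0 := D.F_nonneg t
    have h1 : 0 ≤ 1 - D.F t := by linarith [D.F_le_one t]
    exact mul_nonneg (hdn l hl) (by positivity)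
  have hI : ∫ t, g (D.F t) ∂D.law
      = D.hi * ((∑ l ∈ Finset.Icc 1 N, (C.prize l - C.prize (l + 1)) * l) / (N + 1)) := by
    rw [D.integral_comp_F hg]
    simp only [g]
    rw [intervalIntegral.integral_const_mul, intervalIntegral.integral_finsetSum fun l _ =>
      Continuous.intervalIntegrable (by fun_prop) _ _, Finset.sum_div]
    congr 1
    refine Finset.sum_congr rfl fun l hl => ?_
    rw [intervalIntegral.integral_const_mul, intervalIntegral.integral_const_mul,
      integral_bernstein N (Finset.mem_Icc.mp hl).2]
    ring
  have hhi := D.hi_pos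
  calc _ ≤ k⁻¹ * ((N + 1) * (D.hi * (B / (N + 1)))) := by
        rw [hI] at h
        gcongr
        exact h.trans (by gcongr)
    _ = _ := by field_simp

theorem simpleTotalEffort_full_ge {a : ℝ} (ha : a ∈ Set.Icc D.lo D.hi) (hFa : D.F a = 1 / 4)
    {N : ℕ} (hN : 1 ≤ N) {k B : ℝ} (hk : 0 < k) (hB : 0 < B) :
    a * B / (2 * k) ≤ simpleTotalEffort D k B (N + 1) (N + 1) 1 := by
  -- Serves only to supply nonnegativity of the integrand through `effort_nonneg`.
  let C : Contest B (N + 1) :=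
    Contest.simple hB.le (m := N + 1) (l := 1) (by omega) le_rfl le_rfl (by omega)
  have ha0 : 0 ≤ a := D.lo_nonneg.trans ha.1
  rw [simpleTotalEffort, D.totalEffort_eq k le_rfl]
  let g : ℝ → ℝ := fun p => N.choose 1 * p ^ (N - 1) * (1 - p) ^ 1
  have hg : Continuous g := by
    simp only [g]
    fun_prop
  have hrate : ∀ p, effortRate N (N + 1) (fun r => if r ≤ 1 then B / (1 : ℕ) else 0) p
      * upperTail N (N + 1) p = B * g p := by
    intro p
    rw [effortRate_simple N le_rfl (by omega), upperTail_full, binomialTail_full, div_one,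
      mul_assoc, rankDensity_mul N le_rfl]
    simp [g]
  have hg0 : ∀ t, 0 ≤ g (D.F t) := fun t => by
    have h0 := D.F_nonneg t
    have h1 : 0 ≤ 1 - D.F t := by linarith [D.F_le_one t]
    simp only [g]
    positivity
  have hint := D.integrable_effort N le_rfl (fun r => if r ≤ 1 then B / (1 : ℕ) else 0)
  have hnn := D.effort_nonneg C N
  change 0 ≤ᵐ[D.law] fun t => t * (effortRate N (N + 1)
    (fun r => if r ≤ 1 then B / (1 : ℕ) else 0) (D.F t) * upperTail N (N + 1) (D.F t)) at hnn
  simp_rw [hrate] at hint hnn ⊢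
  have h1 : ∫ t in Set.Ioc a D.hi, a * (B * g (D.F t)) ∂D.law
      ≤ ∫ t, t * (B * g (D.F t)) ∂D.law := by
    refine (integral_mono_of_nonneg (Filter.Eventually.of_forall fun t =>
      mul_nonneg ha0 (mul_nonneg hB.le (hg0 t))) hint.integrableOn ?_).trans
      (setIntegral_le_integral hint hnn)
    filter_upwards [ae_restrict_mem measurableSet_Ioc] with t ht
    exact mul_le_mul_of_nonneg_right ht.1.le (mul_nonneg hB.le (hg0 t))
  rw [integral_const_mul, integral_const_mul, D.setIntegral_comp_F hg ha.1 ha.2 le_rfl, D.F_hi,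
    hFa, integral_bernstein_from N hN] at h1
  -- At least half of the Bernstein mass lies above quantile 1/4. The tail equals 4^(-N) (1 + 3N/4),
  -- and Bernoulli's inequality 1 + 3N ≤ 4^N suffices once N ≥ 1.
  have h2 : binomialTail (N + 1) (1 + 1) (1 / 4) ≤ 1 / 2 := by
    have e : binomialTail (N + 1) (1 + 1) (1 / 4)
        = (1 / 4) ^ N * (1 / 4 + (N + 1) * (3 / 4)) := by
      simp [binomialTail, Finset.sum_range_succ]
      ring
    have hb := one_add_mul_le_pow (a := (3 : ℝ)) (by norm_num) N
    have hN' : (1 : ℝ) ≤ N := by exact_mod_cast hN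
    have h4 : (1 / 4 : ℝ) ^ N * 4 ^ N = 1 := by rw [← mul_pow]; norm_num
    rw [e]
    calc (1 / 4 : ℝ) ^ N * (1 / 4 + (N + 1) * (3 / 4)) ≤ (1 / 4) ^ N * (4 ^ N / 2) := by
          gcongr
          norm_num at hb
          linarith
      _ = 1 / 2 := by linear_combination (1 / 2) * h4
  calc a * B / (2 * k) = k⁻¹ * ((N + 1) * (a * (B * ((1 / 2) / (N + 1))))) := by field_simp
    _ ≤ k⁻¹ * ((N + 1) * (a * (B * ((1 - binomialTail (N + 1) (1 + 1) (1 / 4)) / (N + 1))))) := by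
        gcongr
        linarith
    _ ≤ _ := by gcongr

/-- Only quantiles in (1/4, 1/2] are used. `hl3` keeps the last tail term dominant there, and `hl4`
makes the shortlist a quarter of the field. The constant is 1/64 = (1/4) · (1/2) · (1/8): mass of
the window, effort rate over B, upper tail. -/
theorem simpleTotalEffort_ge {a : ℝ} (ha : a ∈ Set.Icc D.lo D.hi) (hFa : D.F a = 1 / 4)
    {N l : ℕ} (hl : 1 ≤ l) (hl3 : 3 * l ≤ N + 1) (hl4 : N + 1 ≤ 4 * (l + 1)) {k B : ℝ}
    (hk : 0 < k) (hB : 0 < B) :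
    (N + 1) * (a * B / (64 * k)) ≤ simpleTotalEffort D k B (l + 1) (N + 1) l := by
  have hlN : l + 1 ≤ N + 1 := by omega
  let C : Contest B (N + 1) :=
    Contest.simple hB.le (m := l + 1) (l := l) (by omega) hlN hl (by omega)
  have ha0 : 0 ≤ a := D.lo_nonneg.trans ha.1
  obtain ⟨b, -, hFb⟩ := D.exists_F_eq (p := 1 / 2) ⟨by norm_num, by norm_num⟩
  have hab : a ≤ b := by
    by_contra h
    have := D.monotone_F (not_le.mp h).le
    rw [hFa, hFb] at this
    norm_num at this
  rw [simpleTotalEffort, D.totalEffort_eq k hlN]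
  have hint := D.integrable_effort N hlN (fun r => if r ≤ l then B / l else 0)
  have hnn := D.effort_nonneg C N
  have h1 : ∫ _ in Set.Ioc a b, a * (B / 16) ∂D.law ≤ ∫ t, t * (effortRate N (l + 1)
      (fun r => if r ≤ l then B / l else 0) (D.F t) * upperTail N (l + 1) (D.F t)) ∂D.law := by
    refine (integral_mono_of_nonneg (Filter.Eventually.of_forall fun _ => by positivity)
      hint.integrableOn ?_).trans (setIntegral_le_integral hint hnn)
    filter_upwards [ae_restrict_mem measurableSet_Ioc] with t ht
    have hp : 1 / 4 ≤ D.F t := hFa ▸ D.monotone_F ht.1.le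
    have hp2 : D.F t ≤ 1 / 2 := hFb ▸ D.monotone_F ht.2
    have hU : (1 : ℝ) / 8 ≤ upperTail N (l + 1) (D.F t) := by
      refine le_trans ?_ (upperTail_lower N hlN (by linarith) hp2)
      have : ((N + 1 : ℕ) : ℝ) ≤ (4 * (l + 1) : ℕ) := by exact_mod_cast hl4
      push_cast at this ⊢
      rw [div_le_div_iff₀ (by norm_num) (by positivity)]
      linarith
    have hW : B / 2 ≤ effortRate N (l + 1) (fun r => if r ≤ l then B / l else 0) (D.F t) := by
      rw [effortRate_simple N hl (Nat.lt_succ_self l)]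
      have hl0 : (0 : ℝ) < l := by exact_mod_cast hl
      calc B / 2 = B / l * (l / 2) := by field_simp
        _ ≤ _ := by
          exact mul_le_mul_of_nonneg_left (rankDensity_div_lower N hl hl3 (by linarith) hp2)
            (by positivity)
    calc a * (B / 16) = a * (B / 2 * (1 / 8)) := by ring
      _ ≤ _ := by
        have h3 := ht.1.le
        have h4 : 0 ≤ t := ha0.trans h3
        have h5 := (by positivity : 0 ≤ B / 2).trans hW
        gcongr
  rw [setIntegral_const, D.measureReal_Ioc hab, hFa, hFb, smul_eq_mul] at h1
  calc _ = k⁻¹ * ((N + 1) * ((1 / 2 - 1 / 4) * (a * (B / 16)))) := by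
        field_simp
        ring
    _ ≤ _ := by gcongr

end AbilityDistribution

/-! ### Combining the four bounds -/

theorem ratio_bounds {n a H B k X Y : ℝ} (hn : 0 ≤ n) (ha : 0 < a) (hH : 0 < H) (hB : 0 < B)
    (hk : 0 < k) (hX : n * (a * B / (64 * k)) ≤ X) (hX' : X ≤ n * (H * B / k))
    (hY : a * B / (2 * k) ≤ Y) (hY' : Y ≤ H * B / k) :
    a / (64 * H) * n ≤ X / Y ∧ X / Y ≤ 2 * H / a * n := by
  have hY0 : 0 < Y := lt_of_lt_of_le (by positivity) hY
  constructor
  · rw [le_div_iff₀ hY0]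
    calc a / (64 * H) * n * Y ≤ a / (64 * H) * n * (H * B / k) := by gcongr
      _ = n * (a * B / (64 * k)) := by field_simp
      _ ≤ X := hX
  · rw [div_le_iff₀ hY0]
    calc X ≤ n * (H * B / k) := hX'
      _ = 2 * H / a * n * (a * B / (2 * k)) := by field_simp
      _ ≤ _ := by gcongr

theorem mainTheorem9 (D : AbilityDistribution) :
    ∃ c₁ c₂ : ℝ, 0 < c₁ ∧ 0 < c₂ ∧ ∃ N : ℕ, ∀ n : ℕ, N ≤ n → ∀ k B : ℝ, 0 < k → 0 < B →
      (∀ m : ℕ, IsOptimalSize D k B n m →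
        c₁ * n ≤ simpleTotalEffort D k B m n (m - 1) / simpleTotalEffort D k B n n 1 ∧
        simpleTotalEffort D k B m n (m - 1) / simpleTotalEffort D k B n n 1 ≤ c₂ * n) ∧
      (∀ C C₀ : Contest B n, C.IsOptimal D k → C₀.IsOptimalWithoutShortlist D k →
        c₁ * n ≤ C.TE D k / C₀.TE D k ∧ C.TE D k / C₀.TE D k ≤ c₂ * n) := by
  obtain ⟨a, ha, hFa⟩ := D.exists_F_eq (p := 1 / 4) ⟨by norm_num, by norm_num⟩
  have hH := D.hi_pos
  -- The lower end lo may be 0; the quartile a is positive because F vanishes at lo but not at a.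
  have ha0 : 0 < a := by
    refine lt_of_le_of_ne (D.lo_nonneg.trans ha.1) fun h => ?_
    have h1 := D.monotone_F (show a ≤ D.lo from h ▸ D.lo_nonneg)
    rw [hFa, D.F_lo] at h1
    norm_num at h1
  refine ⟨a / (64 * D.hi), 2 * D.hi / a, by positivity, by positivity, 4, ?_⟩
  intro n hn k B hk hB
  obtain ⟨N, rfl⟩ : ∃ N, n = N + 1 := ⟨n - 1, by omega⟩
  -- The witness is l = ⌊n/4⌋: it meets both 3l ≤ n and n ≤ 4(l + 1), and the threshold n ≥ 4 makes
  -- it at least 1.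
  have hl : 1 ≤ (N + 1) / 4 := by omega
  have hlow := D.simpleTotalEffort_ge ha hFa hl (N := N) (by omega) (by omega) hk hB
  have hlow₀ := D.simpleTotalEffort_full_ge ha hFa (N := N) (by omega) hk hB
  rw [Nat.cast_add_one]
  refine ⟨fun m hm => ?_, fun C C₀ hC hC₀ => ?_⟩
  · obtain ⟨h2, hmn, hopt⟩ := hm
    exact ratio_bounds (by positivity) ha0 hH hB hk
      (hlow.trans (hopt ((N + 1) / 4 + 1) (by omega) (by omega)))
      (D.TE_le (Contest.simple hB.le (m := m) (l := m - 1) h2 hmn (by omega) (by omega)) hk)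
      hlow₀
      (D.TE_le_of_size_eq (Contest.simple hB.le (m := N + 1) (l := 1) (by omega) le_rfl le_rfl
        (by omega)) rfl hk)
  · exact ratio_bounds (by positivity) ha0 hH hB hk
      (hlow.trans (hC (Contest.simple hB.le (m := (N + 1) / 4 + 1) (l := (N + 1) / 4) (by omega)
        (by omega) hl (by omega))))
      (D.TE_le C hk)
      (hlow₀.trans (hC₀.2 (Contest.simple hB.le (m := N + 1) (l := 1) (by omega) le_rfl le_rfl
        (by omega)) rfl))
      (D.TE_le_of_size_eq C₀ hC₀.1 hk)
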